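/- Let $\mathbb X=(X_n)_{n\ge1}$ be a strictly stationary sequence of real random variables on a probability space $(\Omega,\mathcal F,\mathbb P)$, let $a>0$, and let $(k_n)_{n\ge1}$ be integers with $1\le k_n\le n$ for all $n$ and $k_n/n\to1$. Let $\mathcal I^{\mathbb X}$ be the $\sigma$-field of all sets $A\subseteq\Omega$ for which there is a Borel set $B\subseteq\mathbb R^{\mathbb N}$ with $A=\{\omega:(X_i(\omega),X_{i+1}(\omega),\dots)\in B\}$ for every $i\ge1$. Let $\gamma_1$ be the conditional right endpoint of the support of $X_1$ given $\mathcal I^{\mathbb X}$, that is, (a version of) the a.s. smallest $\mathcal I^{\mathbb X}$-measurable $[-\infty,\infty]$-valued random variable with $\mathbb P(X_1\le\gamma_1\mid\mathcal I^{\mathbb X})=1$ a.s. Assume $$\mathbb P(X_1=\gamma_1)=0\qquad\text{and}\qquad \mathbb P(X_1=\gamma_1-a)=0 .$$ Let $(N(t))_{t\ge0}$ be a process of non-negative integer-valued random variables, $Z$ an almost surely positive (real) random variable, all on the same probability space, and $c:[0,\infty)\to(0,\infty)$ a function with $c(t)\to\infty$ as $t\to\infty$. Write $X_{1:n}\le\dots\le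 X_{n:n}$ for the order statistics of $X_1,\dots,X_n$ and put $$\mathcal K_t(k_{N(t)},a)=\sum_{i=1}^{N(t)} I\big(X_{k_{N(t)}:N(t)}-a<X_i<X_{k_{N(t)}:N(t)}\big),\qquad W=I(\gamma_1<\infty)\cdot\mathbb P(X_1>\gamma_1-a\mid\mathcal I^{\mathbb X}),$$ the sum being $0$ when $N(t)=0$. All limits are as $t\to\infty$. (i) If $N(t)/c(t)\to Z$ almost surely, then $\mathcal K_t(k_{N(t)},a)/c(t)\to Z\cdot W$ almost surely. If $N(t)/c(t)\to Z$ in probability, then $\mathcal K_t(k_{N(t)},a)/c(t)\to Z\cdot W$ in probability. (ii) Suppose $N(t)/c(t)\to Z$ in distribution. If $W$ is degenerate (almost surely constant), then $\mathcal K_t(k_{N(t)},a)/c(t)\to Z\cdot W$ in distribution. If $Z$ is degenerate, then $N(t)/c(t)\to Z$ in probability, and hence $\mathcal K_t(k_{N(t)},a)/c(t)\to Z\cdot W$ in probability. -/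

import Mathlib

open MeasureTheory ProbabilityTheory Filter Topology
open scoped NNReal

namespace NearMax

/-- The `k`-th smallest among `x 0, …, x (n - 1)` (counted with multiplicity), for `1 ≤ k ≤ n`.
Sequences are indexed from `0`, so `x i` is the `(i + 1)`-st term. For other `k` the value is `0`
by convention. -/
noncomputable def orderStat (x : ℕ → ℝ) (k n : ℕ) : ℝ :=
  if h : 1 ≤ k ∧ k ≤ n then
    x (Tuple.sort (fun i : Fin n => x i) ⟨k - 1, by omega⟩)
  else 0

/-- The number of those among the first `n` terms of `x` that lie in the open interval of length
`a` to the left of the `k`-th order statistic of these `n` terms. -/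
noncomputable def nearCount (x : ℕ → ℝ) (k n : ℕ) (a : ℝ) : ℕ :=
  ((Finset.range n).filter
    (fun i => orderStat x k n - a < x i ∧ x i < orderStat x k n)).card

/-- Strict stationarity: every shifted sequence has the same law on `ℝ^ℕ` as the sequence. -/
def StrictlyStationary {Ω : Type*} [MeasurableSpace Ω] (μ : Measure Ω) (X : ℕ → Ω → ℝ) : Prop :=
  ∀ h : ℕ, IdentDistrib (fun ω (n : ℕ) => X (n + h) ω) (fun ω (n : ℕ) => X n ω) μ μ

/-- The sigma-field of the sets invariant with respect to the sequence `X`: those `A` for which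
there is one Borel set `B` of `ℝ^ℕ` with `A = {ω | (X i ω, X (i + 1) ω, …) ∈ B}` for every `i`. -/
@[reducible]
def invariantSigma {Ω : Type*} (X : ℕ → Ω → ℝ) : MeasurableSpace Ω where
  MeasurableSet' A := ∃ B : Set (ℕ → ℝ), MeasurableSet B ∧
    ∀ i : ℕ, A = {ω | (fun n : ℕ => X (i + n) ω) ∈ B}
  measurableSet_empty := ⟨∅, MeasurableSet.empty, fun _ => by simp⟩
  measurableSet_compl := by
    rintro A ⟨B, hB, hA⟩
    exact ⟨Bᶜ, hB.compl, fun i => by rw [hA i]; rfl⟩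
  measurableSet_iUnion := by
    intro f hf
    choose B hB hA using hf
    refine ⟨⋃ j, B j, MeasurableSet.iUnion hB, fun i => ?_⟩
    ext ω
    simp only [Set.mem_iUnion, Set.mem_ofPred_eq]
    refine exists_congr fun j => ?_
    rw [hA j i]
    rfl

lemma invariantSigma_le {Ω : Type*} [mΩ : MeasurableSpace Ω] {X : ℕ → Ω → ℝ}
    (hX : ∀ n, Measurable (X n)) : invariantSigma X ≤ mΩ := by
  rintro A ⟨B, hB, hA⟩
  rw [hA 0]
  exact (measurable_pi_lambda _ fun n => hX (0 + n)) hB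

/-- `Q` is (a version of) the conditional right endpoint of the support of `X` given `𝓖`: the
a.s. smallest `𝓖`-measurable extended random variable with `P(X ≤ Q | 𝓖) = 1` a.s. -/
structure IsCondRightEndpoint {Ω : Type*} [MeasurableSpace Ω] (μ : Measure Ω)
    (X : Ω → ℝ) (𝓖 : MeasurableSpace Ω) (Q : Ω → EReal) : Prop where
  measurable : Measurable[𝓖] Q
  condProb_eq_one : ∀ᵐ ω ∂μ, (μ⟦{ω' | (X ω' : EReal) ≤ Q ω'} | 𝓖⟧) ω = 1
  minimal : ∀ Q' : Ω → EReal, Measurable[𝓖] Q' →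
    (∀ᵐ ω ∂μ, (μ⟦{ω' | (X ω' : EReal) ≤ Q' ω'} | 𝓖⟧) ω = 1) → ∀ᵐ ω ∂μ, Q ω ≤ Q' ω

lemma condProb_eq_one_iff {Ω : Type*} {𝓖 : MeasurableSpace Ω} [mΩ : MeasurableSpace Ω]
    {μ : Measure Ω} [IsProbabilityMeasure μ] (h𝓖 : 𝓖 ≤ mΩ) {A : Set Ω}
    (hA : MeasurableSet A) :
    (∀ᵐ ω ∂μ, (μ⟦A | 𝓖⟧) ω = 1) ↔ ∀ᵐ ω ∂μ, ω ∈ A := by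
  constructor
  · intro h
    have h1 : ∫ ω, (μ⟦A | 𝓖⟧) ω ∂μ = ∫ _ω, (1 : ℝ) ∂μ := integral_congr_ae h
    rw [integral_condExp h𝓖] at h1
    have h2 : μ.real A = 1 := by simpa [integral_indicator hA] using h1
    have h3 : μ A = 1 := by
      rw [← ENNReal.toReal_eq_one_iff]
      exact h2
    exact (prob_compl_eq_zero_iff hA).2 h3
  · intro h
    have h1 : A.indicator (fun _ => (1 : ℝ)) =ᵐ[μ] fun _ => 1 := by
      filter_upwards [h] with ω hω
      simp [hω]
    have h2 := condExp_congr_ae (m := 𝓖) h1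
    rw [condExp_const h𝓖] at h2
    exact h2

/-- A conditional right endpoint always exists. -/
theorem exists_isCondRightEndpoint {Ω : Type*} {𝓖 : MeasurableSpace Ω} [mΩ : MeasurableSpace Ω]
    (μ : Measure Ω) [IsProbabilityMeasure μ] {X : Ω → ℝ} (hX : Measurable X)
    (h𝓖 : 𝓖 ≤ mΩ) : ∃ Q : Ω → EReal, IsCondRightEndpoint μ X 𝓖 Q := by
  classical
  let A : ℚ → Set Ω := fun q => {ω | X ω ≤ (q : ℝ)}
  have hA : ∀ q, MeasurableSet (A q) := fun q => measurableSet_le hX measurable_const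
  let f : ℚ → Ω → ℝ := fun q => μ⟦A q | 𝓖⟧
  have hf : ∀ q, Measurable[𝓖] (f q) := fun q => stronglyMeasurable_condExp.measurable
  have hint : ∀ q, Integrable ((A q).indicator fun _ => (1 : ℝ)) μ := fun q =>
    (integrable_const 1).indicator (hA q)
  let S : ℚ → Set Ω := fun q => {ω | 1 ≤ f q ω}
  have hS : ∀ q, MeasurableSet[𝓖] (S q) := fun q => @measurableSet_le _ _ _ _ _ 𝓖 _ _ _ _ _
    (@measurable_const _ _ _ 𝓖 _) (hf q)
  let Q : Ω → EReal := fun ω => ⨅ q : ℚ, if ω ∈ S q then ((q : ℝ) : EReal) else ⊤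
  have hQ : Measurable[𝓖] Q := by
    refine Measurable.iInf fun q => ?_
    exact Measurable.ite (f := fun _ => ((q : ℝ) : EReal)) (g := fun _ => ⊤) (hS q)
      measurable_const measurable_const
  have hle : ∀ R : Ω → EReal, Measurable[𝓖] R → MeasurableSet {ω | (X ω : EReal) ≤ R ω} :=
    fun R hR => measurableSet_le (measurable_coe_real_ereal.comp hX) (hR.mono h𝓖 le_rfl)
  refine ⟨Q, hQ, ?_, ?_⟩
  · rw [condProb_eq_one_iff h𝓖 (hle Q hQ)]
    have key : ∀ q, ∀ᵐ ω ∂μ, ω ∈ S q → X ω ≤ (q : ℝ) := by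
      intro q
      have h1 : ∫ ω in S q, f q ω ∂μ = μ.real (S q ∩ A q) := by
        rw [setIntegral_condExp h𝓖 (hint q) (hS q)]
        simp [integral_indicator (hA q), Measure.real, Measure.restrict_apply (hA q), Set.inter_comm]
      have h2 : μ.real (S q) ≤ ∫ ω in S q, f q ω ∂μ := by
        have := setIntegral_mono_on (μ := μ) (s := S q) (f := fun _ => (1 : ℝ)) (g := f q)
          (integrable_const 1).integrableOn integrable_condExp.integrableOn (h𝓖 _ (hS q))
          (fun ω hω => hω)
        simpa using this
      have h3 : μ.real (S q \ A q) = 0 := by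
        have := measureReal_inter_add_sdiff (μ := μ) (s := S q) (hA q)
        have h4 := measureReal_nonneg (μ := μ) (s := S q \ A q)
        linarith
      have h5 : μ (S q \ A q) = 0 := by
        rwa [measureReal_eq_zero_iff] at h3
      rw [ae_iff]
      refine measure_mono_null (fun ω hω => ?_) h5
      simp only [Set.mem_ofPred_eq, Classical.not_imp] at hω
      exact ⟨hω.1, hω.2⟩
    filter_upwards [ae_all_iff.2 key] with ω hω
    refine le_iInf fun q => ?_
    split_ifs with h
    · exact EReal.coe_le_coe_iff.2 (hω q h)
    · exact le_top
  · intro R hR hR1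
    rw [condProb_eq_one_iff h𝓖 (hle R hR)] at hR1
    have key : ∀ q : ℚ, ∀ᵐ ω ∂μ, R ω ≤ ((q : ℝ) : EReal) → ω ∈ S q := by
      intro q
      have hT : MeasurableSet[𝓖] {ω | R ω ≤ ((q : ℝ) : EReal)} :=
        @measurableSet_le _ _ _ _ _ 𝓖 _ _ _ _ _ hR (@measurable_const _ _ _ 𝓖 _)
      have h0 : ((A q).indicator (fun _ => (1 : ℝ)) - fun _ => (1 : ℝ))
          =ᵐ[μ.restrict {ω | R ω ≤ ((q : ℝ) : EReal)}] 0 := by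
        rw [Filter.EventuallyEq, ae_restrict_iff' (h𝓖 _ hT)]
        filter_upwards [hR1] with ω h1 h2
        have : X ω ≤ (q : ℝ) := EReal.coe_le_coe_iff.1 (le_trans h1 h2)
        have h3 : ω ∈ A q := this
        simp [h3]
      have h1 := condExp_ae_eq_restrict_zero hT h0
      rw [Filter.EventuallyEq, ae_restrict_iff' (h𝓖 _ hT)] at h1
      have h2 := condExp_sub (hint q) (integrable_const (1 : ℝ)) (μ := μ) 𝓖
      rw [condExp_const h𝓖] at h2
      filter_upwards [h1, h2] with ω h3 h4 h5
      have h6 := h3 h5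
      rw [h4] at h6
      have h7 : f q ω - 1 = 0 := h6
      exact (sub_eq_zero.1 h7).ge
    filter_upwards [ae_all_iff.2 key] with ω hω
    refine le_of_forall_gt fun y hy => ?_
    obtain ⟨q, hq1, hq2⟩ := EReal.lt_iff_exists_rat_btwn.1 hy
    refine lt_of_le_of_lt (iInf_le _ q) ?_
    rw [if_pos (hω q hq1.le)]
    exact hq2

/-- `I(γ < ∞) · P(X > γ - a | 𝓖)`. -/
noncomputable def limitProportion {Ω : Type*} [MeasurableSpace Ω] (μ : Measure Ω)
    (X : Ω → ℝ) (𝓖 : MeasurableSpace Ω) (γ : Ω → EReal) (a : ℝ) : Ω → ℝ :=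
  Set.indicator {ω | γ ω < ⊤} (μ⟦{ω' | γ ω' - (a : EReal) < (X ω' : EReal)} | 𝓖⟧)

/-- A random variable is degenerate if it is almost surely equal to a constant. -/
def Degenerate {Ω : Type*} [MeasurableSpace Ω] (μ : Measure Ω) (W : Ω → ℝ) : Prop :=
  ∃ r : ℝ, ∀ᵐ ω ∂μ, W ω = r

end NearMax

/-! Write M for the order statistic of rank k_n. Every term is a.s. at most γ, so M ≤ γ. An
invariant threshold below γ is exceeded by a positive limiting proportion of terms, while only o(n)
ranks lie above k_n, so M eventually passes that threshold and M → γ. For finite γ the window (M -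
a, M) then differs from (γ - a, ∞) only near γ and just below γ - a, and the atom conditions make
the proportion of terms there negligible. For γ = ∞ the window escapes to infinity. Hence the
near-maximal proportion tends a.s. to W (`tendsto_nearCount_div`,
`StrictlyStationary.ae_tendsto_nearCount_div`).

The proportions converge by the pointwise ergodic theorem (`StrictlyStationary.ae_tendsto_average`),
derived from the maximal ergodic theorem. It applies to random thresholds because an invariant
variable is one fixed function of every shifted sequence.

To pass to N(t), factor K/c = (N/c)(K/N). Since Z > 0 and c → ∞, N → ∞ in the relevant mode. Almost
sure convergence is pathwise, convergence in probability follows by subsequences, and convergence in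
distribution by Slutsky's theorem with K/N tending to a constant. -/

open MeasureTheory ProbabilityTheory Filter Topology
open scoped NNReal

namespace NearMax

/-! ### Maximal ergodic theorem (Garsia's argument) -/

section MaximalErgodic

variable {α : Type*} {T : α → α} {f : α → ℝ}

/-- `max (S_0, …, S_n)` for the Birkhoff sums `S_j` of `f`. -/
noncomputable def maxBirkhoffSum (T : α → α) (f : α → ℝ) : ℕ → α → ℝ
  | 0 => fun _ => 0
  | n + 1 => fun x => max (maxBirkhoffSum T f n x) (birkhoffSum T f (n + 1) x)

lemma maxBirkhoffSum_nonneg (n : ℕ) (x : α) : 0 ≤ maxBirkhoffSum T f n x := by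
  induction n with
  | zero => exact le_rfl
  | succ n ih => exact le_max_of_le_left ih

lemma maxBirkhoffSum_mono (x : α) : Monotone fun n => maxBirkhoffSum T f n x :=
  monotone_nat_of_le_succ fun _ => le_max_left _ _

lemma birkhoffSum_le_maxBirkhoffSum (n : ℕ) (x : α) :
    birkhoffSum T f n x ≤ maxBirkhoffSum T f n x := by
  cases n with
  | zero => simp [maxBirkhoffSum]
  | succ n => exact le_max_right _ _

/-- Each nonempty sum splits as S_{m+1}(x) = f(x) + S_m(Tx). This is the pointwise inequality behind
Garsia's proof. -/
lemma maxBirkhoffSum_le (n : ℕ) (x : α) :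
    maxBirkhoffSum T f n x ≤ max 0 (f x + maxBirkhoffSum T f n (T x)) := by
  suffices h : ∀ m ≤ n, maxBirkhoffSum T f m x ≤ max 0 (f x + maxBirkhoffSum T f n (T x)) from
    h n le_rfl
  intro m hm
  induction m with
  | zero => exact le_max_left _ _
  | succ m ih =>
    refine max_le (ih (by omega)) (le_max_of_le_right ?_)
    rw [birkhoffSum_succ']
    have h1 := birkhoffSum_le_maxBirkhoffSum (T := T) (f := f) m (T x)
    have h2 := maxBirkhoffSum_mono (T := T) (f := f) (T x) (show m ≤ n by omega)
    dsimp only at h2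
    linarith

/-- The set where the upper limit of the Birkhoff averages of `f` is positive. -/
def limsupPos (T : α → α) (f : α → ℝ) : Set α :=
  {x | ∃ m : ℕ, ∃ᶠ n : ℕ in atTop, (n : ℝ) / (m + 1) < birkhoffSum T f n x}

/-- Lowering the slope from 1/(m+1) to 1/(m+2) frees n/((m+1)(m+2)), which eventually absorbs any
constant C. -/
lemma frequently_shift_of_frequently {u v : ℕ → ℝ} {C : ℝ} {m : ℕ}
    (huv : ∀ n : ℕ, u n ≤ v n + C)
    (h : ∃ᶠ n : ℕ in atTop, (n : ℝ) / (m + 1) < u n) :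
    ∃ᶠ n : ℕ in atTop, (n : ℝ) / ((m + 1 : ℕ) + 1) < v n := by
  have hev : ∀ᶠ n : ℕ in atTop, C * ((m + 1) * (m + 2)) ≤ (n : ℝ) :=
    tendsto_natCast_atTop_atTop.eventually_ge_atTop _
  refine (h.and_eventually hev).mono fun n hn => ?_
  have h1 : (n : ℝ) / ((m + 1 : ℕ) + 1) + C ≤ (n : ℝ) / (m + 1) := by
    have h2 : (n : ℝ) / (m + 1) - (n : ℝ) / ((m + 1 : ℕ) + 1) = n / ((m + 1) * (m + 2)) := by
      push_cast
      field_simp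
      ring
    have h3 : C ≤ n / ((m + 1) * (m + 2)) := by
      rw [le_div_iff₀ (by positivity)]
      exact hn.2
    linarith
  linarith [huv n, hn.1]

lemma preimage_limsupPos : T ⁻¹' limsupPos T f = limsupPos T f := by
  have hs : ∀ x n, birkhoffSum T f n (T x) - birkhoffSum T f (n + 1) x = - f x := fun x n => by
    rw [birkhoffSum_succ']; ring
  ext x
  constructor
  · rintro ⟨m, h⟩
    -- The slope drops twice: once to absorb f x, once for the change of index from n to n + 1.
    refine ⟨m + 2, ?_⟩
    have h1 := frequently_shift_of_frequently (v := fun n => birkhoffSum T f (n + 1) x)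
      (C := - f x) (fun n => by linarith [hs x n]) h
    have h2 : ∃ᶠ n : ℕ in atTop,
        ((n + 1 : ℕ) : ℝ) / (((m + 2 : ℕ) : ℝ) + 1) < birkhoffSum T f (n + 1) x := by
      have h3 := frequently_shift_of_frequently
        (v := fun n => birkhoffSum T f (n + 1) x - 1) (C := 1) (fun n => by linarith) h1
      refine h3.mono fun n hn => ?_
      have h4 : ((n + 1 : ℕ) : ℝ) / (((m + 2 : ℕ) : ℝ) + 1)
          ≤ (n : ℝ) / (((m + 1 + 1 : ℕ) : ℝ) + 1) + 1 := by
        push_cast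
        rw [← sub_nonneg]
        have : (n : ℝ) / (m + 1 + 1 + 1) + 1 - (n + 1) / (m + 2 + 1) = (m + 2) / (m + 3) := by
          field_simp
          ring
        rw [this]
        positivity
      linarith
    rw [frequently_atTop] at h2 ⊢
    intro b
    obtain ⟨n, hn, h⟩ := h2 b
    exact ⟨n + 1, by omega, h⟩
  · rintro ⟨m, h⟩
    refine ⟨m + 1, frequently_shift_of_frequently
      (u := fun n => birkhoffSum T f (n + 1) x) (C := f x) (fun n => by linarith [hs x n]) ?_⟩
    rw [frequently_atTop] at h ⊢
    intro b
    obtain ⟨n, hn, h⟩ := h (b + 1)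
    obtain ⟨n, rfl⟩ : ∃ k, n = k + 1 := ⟨n - 1, by omega⟩
    refine ⟨n, by omega, lt_of_le_of_lt ?_ h⟩
    push_cast
    gcongr
    linarith

variable [MeasurableSpace α] {ν : Measure α}

lemma integrable_birkhoffSum (hT : MeasurePreserving T ν ν) (hf : Integrable f ν) (n : ℕ) :
    Integrable (birkhoffSum T f n) ν :=
  integrable_finsetSum _ fun i _ => (hT.iterate i).integrable_comp_of_integrable hf

lemma integrable_maxBirkhoffSum (hT : MeasurePreserving T ν ν) (hf : Integrable f ν) (n : ℕ) :
    Integrable (maxBirkhoffSum T f n) ν := by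
  induction n with
  | zero => exact integrable_zero _ _ _
  | succ n ih => exact ih.sup (integrable_birkhoffSum hT hf (n + 1))

lemma measurable_birkhoffSum (hT : Measurable T) (hf : Measurable f) (n : ℕ) :
    Measurable (birkhoffSum T f n) :=
  Finset.measurable_sum _ fun i _ => hf.comp (hT.iterate i)

lemma measurable_maxBirkhoffSum (hT : Measurable T) (hf : Measurable f) (n : ℕ) :
    Measurable (maxBirkhoffSum T f n) := by
  induction n with
  | zero => exact measurable_const
  | succ n ih => exact ih.max (measurable_birkhoffSum hT hf (n + 1))

lemma setIntegral_maxBirkhoffSum_pos_nonneg (hT : MeasurePreserving T ν ν) (hfm : Measurable f)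
    (hf : Integrable f ν) (n : ℕ) : 0 ≤ ∫ x in {x | 0 < maxBirkhoffSum T f n x}, f x ∂ν := by
  have hM := integrable_maxBirkhoffSum hT hf n
  have hMT : Integrable (maxBirkhoffSum T f n ∘ T) ν := hT.integrable_comp_of_integrable hM
  have hms : MeasurableSet {x | 0 < maxBirkhoffSum T f n x} :=
    measurableSet_lt measurable_const (measurable_maxBirkhoffSum hT.measurable hfm n)
  have h1 : ∫ x, maxBirkhoffSum T f n (T x) ∂ν = ∫ x, maxBirkhoffSum T f n x ∂ν := by
    rw [← integral_map hT.measurable.aemeasurable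
      (hT.map_eq.symm ▸ hM.aestronglyMeasurable), hT.map_eq]
  have h2 : ∫ x, (maxBirkhoffSum T f n x - maxBirkhoffSum T f n (T x)) ∂ν = 0 := by
    rw [integral_sub hM (show Integrable (fun x => maxBirkhoffSum T f n (T x)) ν from hMT), h1,
      sub_self]
  rw [← integral_indicator hms]
  -- With M the running maximum, M - M ∘ T is at most f where M > 0, and at most 0 where M = 0. Its
  -- integral vanishes by invariance of ν.
  refine h2.ge.trans (integral_mono (hM.sub hMT) (hf.indicator hms) fun x => ?_)
  by_cases hx : 0 < maxBirkhoffSum T f n x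
  · rw [Set.indicator_of_mem (show x ∈ {x | 0 < maxBirkhoffSum T f n x} from hx)]
    have h3 := maxBirkhoffSum_le (T := T) (f := f) n x
    rcases le_max_iff.1 h3 with h | h <;> dsimp only <;> linarith
  · rw [Set.indicator_of_notMem (show x ∉ {x | 0 < maxBirkhoffSum T f n x} from hx)]
    have h3 := maxBirkhoffSum_nonneg (T := T) (f := f) n (T x)
    dsimp only
    linarith

/-- The maximal ergodic theorem, when some Birkhoff sum is positive almost everywhere. -/
theorem integral_nonneg_of_exists_birkhoffSum_pos (hT : MeasurePreserving T ν ν)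
    (hfm : Measurable f) (hf : Integrable f ν) (hpos : ∀ᵐ x ∂ν, ∃ n, 0 < birkhoffSum T f n x) :
    0 ≤ ∫ x, f x ∂ν := by
  have hms : ∀ n, MeasurableSet {x | 0 < maxBirkhoffSum T f n x} := fun n =>
    measurableSet_lt measurable_const (measurable_maxBirkhoffSum hT.measurable hfm n)
  have hlim : Tendsto (fun n => ∫ x, {x | 0 < maxBirkhoffSum T f n x}.indicator f x ∂ν) atTop
      (𝓝 (∫ x, f x ∂ν)) := by
    refine tendsto_integral_of_dominated_convergence (fun x => ‖f x‖)
      (fun n => (hf.indicator (hms n)).aestronglyMeasurable) hf.norm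
      (fun n => .of_forall fun x => norm_indicator_le_norm_self _ _) ?_
    filter_upwards [hpos] with x ⟨n, hn⟩
    refine tendsto_const_nhds.congr' ?_
    filter_upwards [eventually_ge_atTop n] with m hm
    refine (Set.indicator_of_mem (s := {x | 0 < maxBirkhoffSum T f m x}) ?_ _).symm
    exact (hn.trans_le (birkhoffSum_le_maxBirkhoffSum n x)).trans_le (maxBirkhoffSum_mono x hm)
  refine ge_of_tendsto' hlim fun n => ?_
  rw [integral_indicator (hms n)]
  exact setIntegral_maxBirkhoffSum_pos_nonneg hT hfm hf n

lemma measurableSet_limsupPos (hT : Measurable T) (hf : Measurable f) :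
    MeasurableSet (limsupPos T f) := by
  have : limsupPos T f = ⋃ m : ℕ, limsup
      (fun n : ℕ => {x | (n : ℝ) / (m + 1) < birkhoffSum T f n x}) atTop := by
    ext x
    simp only [limsupPos, Set.mem_iUnion, mem_limsup_iff_frequently_mem]
    rfl
  rw [this]
  exact .iUnion fun m => .measurableSet_limsup fun n =>
    measurableSet_lt measurable_const (measurable_birkhoffSum hT hf n)

theorem setIntegral_limsupPos_nonneg (hT : MeasurePreserving T ν ν) (hfm : Measurable f)
    (hf : Integrable f ν) : 0 ≤ ∫ x in limsupPos T f, f x ∂ν := by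
  have hD := measurableSet_limsupPos hT.measurable hfm
  have hT' : MeasurePreserving T (ν.restrict (limsupPos T f)) (ν.restrict (limsupPos T f)) := by
    have := hT.restrict_preimage hD
    rwa [preimage_limsupPos] at this
  refine integral_nonneg_of_exists_birkhoffSum_pos hT' hfm hf.integrableOn ?_
  filter_upwards [ae_restrict_mem hD] with x ⟨m, hx⟩
  obtain ⟨n, hn⟩ := hx.exists
  exact ⟨n, lt_of_le_of_lt (by positivity) hn⟩

end MaximalErgodic

/-! ### Invariant variables and the pointwise ergodic theorem -/

section Stationary

variable {Ω : Type*} {X : ℕ → Ω → ℝ}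

/-- The sequence of values of `X` from time `i` on. -/
def shiftedPath (X : ℕ → Ω → ℝ) (i : ℕ) (ω : Ω) : ℕ → ℝ := fun n => X (i + n) ω

/-- An invariant random variable is one and the same function of each shifted sequence. -/
lemma exists_eq_comp_shiftedPath {β : Type*} [MeasurableSpace β] [StandardBorelSpace β]
    [Nonempty β] {J : Ω → β} (hJ : Measurable[invariantSigma X] J) :
    ∃ g : (ℕ → ℝ) → β, Measurable g ∧ ∀ i ω, J ω = g (shiftedPath X i ω) := by
  -- Factoring through the path on Ω × ℕ, rather than on Ω for each i, yields a single g valid for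
  -- all shifts.
  let p : Ω × ℕ → ℕ → ℝ := fun z => shiftedPath X z.2 z.1
  have hm : Measurable[MeasurableSpace.comap p inferInstance] fun z : Ω × ℕ => J z.1 := by
    intro C hC
    obtain ⟨B, hB, hA⟩ := hJ hC
    refine ⟨B, hB, ?_⟩
    ext ⟨ω, i⟩
    exact (Set.ext_iff.1 (hA i) ω).symm
  obtain ⟨g, hg, hgJ⟩ := hm.exists_eq_measurable_comp
  exact ⟨g, hg, fun i ω => congrFun hgJ (ω, i)⟩

/-- The shift of sequences. -/
def shift (x : ℕ → ℝ) : ℕ → ℝ := fun n => x (n + 1)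

lemma measurable_shift : Measurable shift :=
  measurable_pi_lambda _ fun n => measurable_pi_apply (n + 1)

lemma shift_iterate_shiftedPath (i j : ℕ) (ω : Ω) :
    shift^[i] (shiftedPath X j ω) = shiftedPath X (j + i) ω := by
  induction i with
  | zero => rfl
  | succ i ih =>
    rw [Function.iterate_succ_apply', ih]
    ext n
    simp only [shift, shiftedPath]
    congr 1
    omega

lemma measurableSet_invariantSigma_of_preimage_shift {D : Set (ℕ → ℝ)} (hD : MeasurableSet D)
    (hinv : shift ⁻¹' D = D) : MeasurableSet[invariantSigma X] (shiftedPath X 0 ⁻¹' D) := by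
  refine ⟨D, hD, fun i => ?_⟩
  ext ω
  have h1 : shift^[i] ⁻¹' D = D := by
    induction i with
    | zero => rfl
    | succ i ih => rw [Function.iterate_succ, Set.preimage_comp, ih, hinv]
  change shiftedPath X 0 ω ∈ D ↔ shiftedPath X i ω ∈ D
  conv_lhs => rw [← h1]
  rw [Set.mem_preimage, shift_iterate_shiftedPath, zero_add]

variable [mΩ : MeasurableSpace Ω] {μ : Measure Ω}

lemma measurable_shiftedPath (hX : ∀ n, Measurable (X n)) (i : ℕ) :
    Measurable (shiftedPath X i) :=
  measurable_pi_lambda _ fun n => hX (i + n)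

lemma StrictlyStationary.identDistrib_shiftedPath (h : StrictlyStationary μ X) (i : ℕ) :
    IdentDistrib (shiftedPath X i) (shiftedPath X 0) μ μ := by
  have h1 : shiftedPath X i = fun ω n => X (n + i) ω := by
    ext ω n; simp [shiftedPath, add_comm]
  have h2 : shiftedPath X 0 = fun ω n => X n ω := by
    ext ω n; simp [shiftedPath]
  rw [h1, h2]
  exact h i

lemma StrictlyStationary.measurePreserving_shift (h : StrictlyStationary μ X)
    (hX : ∀ n, Measurable (X n)) :
    MeasurePreserving shift (μ.map (shiftedPath X 0)) (μ.map (shiftedPath X 0)) := by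
  refine ⟨measurable_shift, ?_⟩
  rw [Measure.map_map measurable_shift (measurable_shiftedPath hX 0)]
  have : shift ∘ shiftedPath X 0 = shiftedPath X 1 :=
    funext fun ω => shift_iterate_shiftedPath 1 0 ω
  rw [this, (h.identDistrib_shiftedPath 1).map_eq]

variable [IsProbabilityMeasure μ]

/-- The upper half of the pointwise ergodic theorem. -/
lemma StrictlyStationary.ae_eventually_sum_le (h : StrictlyStationary μ X)
    (hX : ∀ n, Measurable (X n)) {F : (ℕ → ℝ) → ℝ} (hF : Measurable F)
    (hFi : Integrable (fun ω => F (shiftedPath X 0 ω)) μ) {ε : ℝ} (hε : 0 < ε) :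
    ∀ᵐ ω ∂μ, ∀ᶠ n : ℕ in atTop, ∑ i ∈ Finset.range n, F (shiftedPath X i ω)
      ≤ n * ((μ[fun ω => F (shiftedPath X 0 ω) | invariantSigma X]) ω + ε) := by
  have hI := invariantSigma_le hX
  set H := μ[fun ω => F (shiftedPath X 0 ω) | invariantSigma X] with hH
  obtain ⟨G, hG, hGH⟩ := exists_eq_comp_shiftedPath (X := X) (J := H)
    stronglyMeasurable_condExp.measurable
  have hHi : Integrable H μ := integrable_condExp
  let f : (ℕ → ℝ) → ℝ := fun x => F x - G x - ε / 2
  have hf : Measurable f := (hF.sub hG).sub measurable_const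
  have hfX : (fun ω => f (shiftedPath X 0 ω)) =
      fun ω => F (shiftedPath X 0 ω) - H ω - ε / 2 := by
    funext ω; simp only [f, ← hGH 0 ω]
  have hfXi : Integrable (fun ω => f (shiftedPath X 0 ω)) μ := by
    rw [hfX]
    exact (hFi.sub hHi).sub (integrable_const _)
  have hp := measurable_shiftedPath hX 0
  have hfi : Integrable f (μ.map (shiftedPath X 0)) :=
    (integrable_map_measure hf.aestronglyMeasurable hp.aemeasurable).2 hfXi
  have hD := measurableSet_limsupPos (T := shift) measurable_shift hf
  have hDI := measurableSet_invariantSigma_of_preimage_shift (X := X) hD preimage_limsupPos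
  have h1 := setIntegral_limsupPos_nonneg (h.measurePreserving_shift hX) hf hfi
  rw [setIntegral_map hD hf.aestronglyMeasurable hp.aemeasurable, hfX,
    integral_sub (show Integrable (fun ω => F (shiftedPath X 0 ω) - H ω) _ from
      (hFi.sub hHi).integrableOn) (integrable_const _),
    integral_sub hFi.integrableOn hHi.integrableOn, hH,
    setIntegral_condExp hI hFi hDI] at h1
  -- Over an invariant event F and its conditional expectation have equal integrals, so `h1` reduces
  -- to 0 ≤ -(ε/2) times the measure of the event.
  have h2 : μ.real (shiftedPath X 0 ⁻¹' limsupPos shift f) = 0 := by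
    have h3 := measureReal_nonneg (μ := μ) (s := shiftedPath X 0 ⁻¹' limsupPos shift f)
    simp at h1
    nlinarith
  rw [measureReal_eq_zero_iff] at h2
  have h4 : ∀ᵐ ω ∂μ, shiftedPath X 0 ω ∉ limsupPos shift f := measure_eq_zero_iff_ae_notMem.1 h2
  -- Off the null event the sums of f are eventually at most n/(m+1) ≤ nε/2; the other ε/2 was
  -- subtracted in f.
  obtain ⟨m, hm⟩ := exists_nat_one_div_lt (half_pos hε)
  filter_upwards [h4] with ω hω
  simp only [limsupPos, Set.mem_ofPred_eq, not_exists, not_frequently, not_lt] at hω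
  filter_upwards [hω m] with n hn
  have h5 : birkhoffSum shift f n (shiftedPath X 0 ω) =
      ∑ i ∈ Finset.range n, F (shiftedPath X i ω) - n * (H ω + ε / 2) := by
    simp only [birkhoffSum, shift_iterate_shiftedPath, zero_add, f, ← hGH]
    simp [Finset.sum_sub_distrib]
    ring
  rw [h5] at hn
  have h6 : (n : ℝ) / (m + 1) ≤ n * (ε / 2) := by
    rw [div_eq_mul_one_div]
    gcongr
  nlinarith

/-- The pointwise ergodic theorem for strictly stationary sequences. -/
theorem StrictlyStationary.ae_tendsto_average (h : StrictlyStationary μ X)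
    (hX : ∀ n, Measurable (X n)) {F : (ℕ → ℝ) → ℝ} (hF : Measurable F)
    (hFi : Integrable (fun ω => F (shiftedPath X 0 ω)) μ) :
    ∀ᵐ ω ∂μ, Tendsto (fun n : ℕ => (∑ i ∈ Finset.range n, F (shiftedPath X i ω)) / (n : ℝ)) atTop
      (𝓝 ((μ[fun ω => F (shiftedPath X 0 ω) | invariantSigma X]) ω)) := by
  have hup : ∀ m : ℕ, _ := fun m => h.ae_eventually_sum_le hX hF hFi
    (Nat.one_div_pos_of_nat (α := ℝ) (n := m))
  -- The lower half is the upper half for -F.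
  have hlo : ∀ m : ℕ, _ := fun m => h.ae_eventually_sum_le hX hF.neg hFi.neg
    (Nat.one_div_pos_of_nat (α := ℝ) (n := m))
  have hneg := condExp_neg (μ := μ) (fun ω => F (shiftedPath X 0 ω)) (invariantSigma X)
  filter_upwards [ae_all_iff.2 hup, ae_all_iff.2 hlo, hneg] with ω h1 h2 h3
  rw [Metric.tendsto_nhds]
  intro ε hε
  obtain ⟨m, hm⟩ := exists_nat_one_div_lt hε
  filter_upwards [h1 m, h2 m, eventually_gt_atTop 0] with n hn1 hn2 hn
  have hn' : (0 : ℝ) < n := by exact_mod_cast hn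
  have h3' : (μ[fun ω => (-F) (shiftedPath X 0 ω) | invariantSigma X]) ω =
    -(μ[fun ω => F (shiftedPath X 0 ω) | invariantSigma X]) ω := h3
  rw [h3'] at hn2
  simp only [Pi.neg_apply, Finset.sum_neg_distrib] at hn2
  rw [Real.dist_eq, abs_sub_lt_iff]
  constructor
  · rw [sub_lt_iff_lt_add, div_lt_iff₀ hn']
    nlinarith
  · rw [sub_lt_comm, lt_div_iff₀ hn']
    nlinarith

end Stationary

/-! ### Order statistics through counting, and measurability -/

section OrderStatistics

variable {x : ℕ → ℝ} {k n : ℕ} {a s : ℝ}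

lemma exists_orderStat_eq (h : 1 ≤ k ∧ k ≤ n) : ∃ i < n, orderStat x k n = x i := by
  rw [orderStat, dif_pos h]
  exact ⟨_, Fin.is_lt _, rfl⟩

/-- The sorting permutation carries the ranks up to k to k indices. Conversely, if the k-th value
exceeds s, only the k - 1 smaller ranks can have values at most s. -/
lemma orderStat_le_iff (h : 1 ≤ k ∧ k ≤ n) :
    orderStat x k n ≤ s ↔ k ≤ ((Finset.range n).filter (fun i => x i ≤ s)).card := by
  set σ := Tuple.sort (fun i : Fin n => x i) with hσ
  have hmono : Monotone fun j => x (σ j) := Tuple.monotone_sort (fun i : Fin n => x i)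
  have hos : orderStat x k n = x (σ ⟨k - 1, by omega⟩) := by rw [orderStat, dif_pos h]
  rw [hos]
  have hinj : Function.Injective fun j : Fin n => (σ j : ℕ) :=
    Fin.val_injective.comp σ.injective
  constructor
  · intro hs
    have h1 : (Finset.univ.filter fun j : Fin n => (j : ℕ) < k).card = k := by
      rw [Fin.card_filter_val_lt, min_eq_right h.2]
    rw [← h1]
    refine Finset.card_le_card_of_injOn (fun j : Fin n => (σ j : ℕ)) ?_ hinj.injOn
    intro j hj
    simp only [Finset.coe_filter, Finset.mem_univ, true_and, Set.mem_ofPred_eq,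
      Finset.mem_range] at hj ⊢
    exact ⟨Fin.is_lt _, (hmono (Fin.le_def.2 (by simp; omega))).trans hs⟩
  · intro hs
    by_contra! hlt
    have h1 : (Finset.range n).filter (fun i => x i ≤ s) ⊆
        (Finset.univ.filter fun j : Fin n => (j : ℕ) < k - 1).image (fun j => (σ j : ℕ)) := by
      intro i hi
      simp only [Finset.mem_filter, Finset.mem_range, Finset.mem_image, Finset.mem_univ,
        true_and] at hi ⊢
      refine ⟨σ.symm ⟨i, hi.1⟩, ?_, by simp⟩
      by_contra! hle
      have h2 := hmono (show (⟨k - 1, by omega⟩ : Fin n) ≤ σ.symm ⟨i, hi.1⟩ from hle)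
      simp only [Equiv.apply_symm_apply] at h2
      linarith [hi.2]
    have h2 := (Finset.card_le_card h1).trans Finset.card_image_le
    rw [Fin.card_filter_val_lt] at h2
    omega

lemma measurable_card_filter_range {α : Type*} [MeasurableSpace α] (n : ℕ) {p : ℕ → α → Prop}
    [∀ y, DecidablePred fun i => p i y] (hp : ∀ i, MeasurableSet {y | p i y}) :
    Measurable fun y => ((Finset.range n).filter (fun i => p i y)).card := by
  classical
  have : (fun y => ((Finset.range n).filter (fun i => p i y)).card) =
      fun y => ∑ i ∈ Finset.range n, if p i y then 1 else 0 := by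
    ext y; rw [Finset.card_filter]
  rw [this]
  refine Finset.measurable_sum _ fun i _ => ?_
  convert Measurable.ite (hp i) (measurable_const (a := 1)) (measurable_const (a := 0))

lemma measurable_orderStat (k n : ℕ) : Measurable fun x => orderStat x k n := by
  by_cases h : 1 ≤ k ∧ k ≤ n
  · refine measurable_of_Iic fun s => ?_
    have : (fun x => orderStat x k n) ⁻¹' Set.Iic s =
        {x | k ≤ ((Finset.range n).filter (fun i => x i ≤ s)).card} := by
      ext x; exact orderStat_le_iff h
    rw [this]
    exact measurableSet_le measurable_const (measurable_card_filter_range n fun i =>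
      measurableSet_le (measurable_pi_apply i) measurable_const)
  · simp only [orderStat, dif_neg h]
    exact measurable_const

lemma measurable_nearCount (k n : ℕ) (a : ℝ) : Measurable fun x => nearCount x k n a :=
  measurable_card_filter_range n fun i =>
    (measurableSet_lt ((measurable_orderStat k n).sub_const a) (measurable_pi_apply i)).inter
      (measurableSet_lt (measurable_pi_apply i) (measurable_orderStat k n))

lemma measurable_nearCount_comp {Ω : Type*} [MeasurableSpace Ω] {X : ℕ → Ω → ℝ}
    (hX : ∀ n, Measurable (X n)) {N : Ω → ℕ} (hN : Measurable N) (k : ℕ → ℕ) (a : ℝ) :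
    Measurable fun ω => nearCount (fun n => X n ω) (k (N ω)) (N ω) a := by
  have h1 : Measurable fun z : Ω × ℕ => nearCount (fun n => X n z.1) (k z.2) z.2 a :=
    measurable_from_prod_countable_left fun n =>
      (measurable_nearCount (k n) n a).comp (measurable_pi_lambda _ hX)
  exact h1.comp (measurable_id.prodMk hN)

end OrderStatistics

/-! ### Near-maximal proportions along a fixed sequence -/

section Deterministic

variable {x : ℕ → ℝ} {k : ℕ → ℕ} {a : ℝ} {g : EReal}

/-- A threshold below `g` which increases to `g` as `m → ∞`. -/
noncomputable def lowerThreshold (g : EReal) (m : ℕ) : EReal :=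
  min (g - ((1 / ((m : ℝ) + 1) : ℝ) : EReal)) ((m : ℝ) : EReal)

lemma measurable_lowerThreshold (m : ℕ) : Measurable fun g => lowerThreshold g m := by
  unfold lowerThreshold
  fun_prop

/-- The first entry of the minimum handles finite g, the second g = ⊤. -/
lemma lowerThreshold_lt (hg : g ≠ ⊥) (m : ℕ) : lowerThreshold g m < g := by
  induction g with
  | bot => exact absurd rfl hg
  | top => exact (min_le_right _ _).trans_lt (EReal.coe_lt_top _)
  | coe r =>
    refine (min_le_left _ _).trans_lt ?_
    rw [← EReal.coe_sub, EReal.coe_lt_coe_iff]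
    have : 0 < 1 / ((m : ℝ) + 1) := by positivity
    linarith

lemma lowerThreshold_mono : Monotone (lowerThreshold g) := by
  intro m n hmn
  have h1 : (m : ℝ) ≤ n := by exact_mod_cast hmn
  refine min_le_min (EReal.sub_le_sub le_rfl ?_) ?_
  · rw [EReal.coe_le_coe_iff]
    gcongr
  · rwa [EReal.coe_le_coe_iff]

lemma exists_lt_lowerThreshold {s : ℝ} (h : (s : EReal) < g) :
    ∃ m, (s : EReal) < lowerThreshold g m := by
  induction g with
  | bot => exact absurd h not_lt_bot
  | top =>
    obtain ⟨m, hm⟩ := exists_nat_gt s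
    refine ⟨m, lt_min ?_ (by exact_mod_cast hm)⟩
    rw [EReal.top_sub_coe]
    exact EReal.coe_lt_top _
  | coe r =>
    rw [EReal.coe_lt_coe_iff] at h
    obtain ⟨m₁, h₁⟩ := exists_nat_gt s
    obtain ⟨m₂, h₂⟩ := exists_nat_one_div_lt (sub_pos.2 h)
    refine ⟨max m₁ m₂, lt_min ?_ ?_⟩
    · rw [← EReal.coe_sub, EReal.coe_lt_coe_iff]
      have : 1 / (((max m₁ m₂ : ℕ) : ℝ) + 1) ≤ 1 / ((m₂ : ℝ) + 1) := by
        gcongr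
        exact le_max_right _ _
      linarith
    · rw [EReal.coe_lt_coe_iff]
      exact h₁.trans_le (by exact_mod_cast le_max_left _ _)

open Classical in
/-- The proportion of the first `n` terms of `x` that satisfy `p`. -/
noncomputable def proportion (x : ℕ → ℝ) (p : ℝ → Prop) (n : ℕ) : ℝ :=
  (((Finset.range n).filter fun i => p (x i)).card : ℝ) / n

lemma proportion_mono {p q : ℝ → Prop} {n : ℕ} (h : ∀ i < n, p (x i) → q (x i)) :
    proportion x p n ≤ proportion x q n := by
  classical
  unfold proportion
  gcongr with i hi
  simp only [Finset.mem_range] at *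
  exact h _ (by assumption)

lemma proportion_or_le {p q : ℝ → Prop} {n : ℕ} :
    proportion x (fun y => p y ∨ q y) n ≤ proportion x p n + proportion x q n := by
  classical
  unfold proportion
  rw [← add_div]
  simp only [Finset.filter_or]
  gcongr
  exact_mod_cast Finset.card_union_le _ _

lemma proportion_not {p : ℝ → Prop} {n : ℕ} (hn : 0 < n) :
    proportion x (fun y => ¬ p y) n = 1 - proportion x p n := by
  classical
  have hn' : (n : ℝ) ≠ 0 := by positivity
  unfold proportion
  rw [eq_sub_iff_add_eq, ← add_div, div_eq_one_iff_eq hn', add_comm]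
  have := Finset.card_filter_add_card_filter_not (s := Finset.range n) (fun i => p (x i))
  rw [Finset.card_range] at this
  rw [← Nat.cast_add, Nat.cast_inj]
  convert this

lemma nearCount_div (k n : ℕ) : (nearCount x k n a : ℝ) / n =
    proportion x (fun y => orderStat x k n - a < y ∧ y < orderStat x k n) n := by
  unfold nearCount proportion
  congr!

/-- The order statistics of rank `k n` exceed every threshold that is exceeded by a positive
proportion of the terms. -/
lemma eventually_lt_orderStat (hk : ∀ n, 1 ≤ n → 1 ≤ k n ∧ k n ≤ n)
    (hk_lim : Tendsto (fun n : ℕ => (k n : ℝ) / (n : ℝ)) atTop (𝓝 1)) {t : EReal} {p : ℝ}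
    (hp : 0 < p) (h : Tendsto (proportion x fun y => t < (y : EReal)) atTop (𝓝 p)) :
    ∀ᶠ n in atTop, t < (orderStat x (k n) n : EReal) := by
  -- If the order statistic were at most t, the k n terms not above it and the terms exceeding t
  -- would be disjoint, so these two proportions would sum to at most 1; yet the sum tends to 1 + p.
  have h1 := hk_lim.add h
  filter_upwards [h1.eventually (lt_mem_nhds (show (1 : ℝ) < 1 + p by linarith)),
    eventually_gt_atTop 0] with n hn hn0
  by_contra! hle
  have hn' : (0 : ℝ) < n := by exact_mod_cast hn0
  have h2 := (orderStat_le_iff (x := x) (hk n hn0)).1 le_rfl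
  have h3 : (k n : ℝ) / n ≤ proportion x (fun y => ¬ t < (y : EReal)) n := by
    unfold proportion
    gcongr
    refine h2.trans (Finset.card_le_card ?_)
    intro i hi
    simp only [Finset.mem_filter, not_lt] at hi ⊢
    exact ⟨hi.1, (EReal.coe_le_coe_iff.2 hi.2).trans hle⟩
  rw [proportion_not hn0] at h3
  linarith

/-- Convergence of the proportion of near-maximal terms along a fixed sequence. -/
theorem tendsto_nearCount_div (hk : ∀ n, 1 ≤ n → 1 ≤ k n ∧ k n ≤ n)
    (hk_lim : Tendsto (fun n : ℕ => (k n : ℝ) / (n : ℝ)) atTop (𝓝 1))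
    (hx : ∀ i, (x i : EReal) ≤ g) {q : ℝ} {p r : ℕ → ℝ}
    (hq : Tendsto (proportion x fun y => g - (a : EReal) < (y : EReal)) atTop (𝓝 q))
    (hp : ∀ m, Tendsto (proportion x fun y => lowerThreshold g m < (y : EReal)) atTop (𝓝 (p m)))
    (hr : ∀ m, Tendsto (proportion x fun y => g < ⊤ ∧
      lowerThreshold g m - (a : EReal) < (y : EReal) ∧ (y : EReal) ≤ g - (a : EReal))
        atTop (𝓝 (r m)))
    (hp_pos : ∀ m, 0 < p m) (hp_inf : ∀ ε > 0, ∃ m, p m < ε) (hr_inf : ∀ ε > 0, ∃ m, r m < ε) :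
    Tendsto (fun n => (nearCount x (k n) n a : ℝ) / n) atTop (𝓝 (if g < ⊤ then q else 0)) := by
  have hM : ∀ m, ∀ᶠ n in atTop, lowerThreshold g m < (orderStat x (k n) n : EReal) :=
    fun m => eventually_lt_orderStat hk hk_lim (hp_pos m) (hp m)
  have hMg : ∀ n, 0 < n → (orderStat x (k n) n : EReal) ≤ g := fun n hn => by
    obtain ⟨i, -, hi⟩ := exists_orderStat_eq (x := x) (hk n hn)
    rw [hi]
    exact hx i
  simp_rw [nearCount_div]
  split_ifs with hg
  · obtain ⟨c, rfl⟩ : ∃ c : ℝ, g = c := ⟨g.toReal, (EReal.coe_toReal hg.ne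
      (ne_bot_of_le_ne_bot (EReal.coe_ne_bot (x 0)) (hx 0))).symm⟩
    rw [Metric.tendsto_nhds]
    intro ε hε
    obtain ⟨m, hm⟩ := hp_inf (ε / 2) (by positivity)
    obtain ⟨m', hm'⟩ := hr_inf (ε / 2) (by positivity)
    filter_upwards [hM m, hM m', (hp m).eventually (gt_mem_nhds hm),
      (hr m').eventually (gt_mem_nhds hm'), Metric.tendsto_nhds.1 hq (ε / 2) (by positivity),
      eventually_gt_atTop 0] with n h1 h2 h3 h4 h5 hn
    have hc := EReal.coe_le_coe_iff.1 (hMg n hn)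
    rw [Real.dist_eq, abs_lt] at h5 ⊢
    constructor
    -- A term above c - a is above M - a, as M ≤ c. So it lies in the window or is at least M, hence
    -- beyond the threshold.
    · have h6 : proportion x (fun y => (c : EReal) - (a : EReal) < (y : EReal)) n ≤
          proportion x (fun y => (orderStat x (k n) n - a < y ∧ y < orderStat x (k n) n) ∨
            lowerThreshold c m < (y : EReal)) n := by
        refine proportion_mono fun i _ hi => or_iff_not_imp_right.2 fun hi' => ?_
        rw [← EReal.coe_sub, EReal.coe_lt_coe_iff] at hi
        exact ⟨by linarith, EReal.coe_lt_coe_iff.1 ((not_lt.1 hi').trans_lt h1)⟩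
      linarith [h6.trans proportion_or_le]
    -- A term of the window exceeds M - a, so it is above c - a or in the thin strip just below c -
    -- a.
    · have h6 : proportion x
          (fun y => orderStat x (k n) n - a < y ∧ y < orderStat x (k n) n) n ≤
          proportion x (fun y => (c : EReal) - (a : EReal) < (y : EReal) ∨
            ((c : EReal) < ⊤ ∧ lowerThreshold c m' - (a : EReal) < (y : EReal) ∧
              (y : EReal) ≤ c - (a : EReal))) n := by
        refine proportion_mono fun i _ hi => or_iff_not_imp_left.2 fun hi' =>
          ⟨hg, ?_, not_lt.1 hi'⟩
        refine lt_of_le_of_lt (EReal.sub_le_sub h2.le le_rfl) ?_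
        rw [← EReal.coe_sub, EReal.coe_lt_coe_iff]
        exact hi.1
      linarith [h6.trans proportion_or_le]
  · obtain rfl : g = ⊤ := not_lt_top_iff.1 hg
    rw [Metric.tendsto_nhds]
    intro ε hε
    obtain ⟨m, hm⟩ := hp_inf ε hε
    -- Once M > m + a, the whole window lies above m, where the limiting proportion is below ε.
    obtain ⟨m', hm'⟩ := exists_lt_lowerThreshold (EReal.coe_lt_top ((m : ℝ) + a))
    filter_upwards [hM m', (hp m).eventually (gt_mem_nhds hm)] with n h1 h2
    have h3 : (m : ℝ) + a < orderStat x (k n) n := EReal.coe_lt_coe_iff.1 (hm'.trans h1)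
    have h4 : proportion x (fun y => orderStat x (k n) n - a < y ∧ y < orderStat x (k n) n) n ≤
        proportion x (fun y => lowerThreshold ⊤ m < (y : EReal)) n := by
      refine proportion_mono fun i _ hi => (min_le_right _ _).trans_lt ?_
      rw [EReal.coe_lt_coe_iff]
      linarith [hi.1]
    have h5 : 0 ≤ proportion x
        (fun y => orderStat x (k n) n - a < y ∧ y < orderStat x (k n) n) n := by
      unfold proportion
      positivity
    rw [Real.dist_eq, sub_zero, abs_of_nonneg h5]
    linarith

end Deterministic

/-! ### Conditional endpoint and almost sure convergence of the proportion -/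

section Endpoint

variable {Ω : Type*} {𝓖 : MeasurableSpace Ω} [mΩ : MeasurableSpace Ω] {μ : Measure Ω}
  [IsProbabilityMeasure μ]

/-- By Markov's inequality, the event that all these conditional probabilities are at least 1/(j+1)
has measure at most (j+1) μ(A m), which tends to 0. -/
lemma ae_exists_condProb_lt (h𝓖 : 𝓖 ≤ mΩ) {A : ℕ → Set Ω}
    (hA : ∀ m, MeasurableSet (A m)) (hanti : Antitone A) (h0 : μ (⋂ m, A m) = 0) :
    ∀ᵐ ω ∂μ, ∀ ε > 0, ∃ m, (μ⟦A m | 𝓖⟧) ω < ε := by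
  have key : ∀ j : ℕ, ∀ᵐ ω ∂μ, ∃ m, (μ⟦A m | 𝓖⟧) ω < 1 / ((j : ℝ) + 1) := by
    intro j
    have hj : 0 < 1 / ((j : ℝ) + 1) := by positivity
    set S : Set Ω := {ω | ∀ m, 1 / ((j : ℝ) + 1) ≤ (μ⟦A m | 𝓖⟧) ω} with hS
    have hle : ∀ m, 1 / ((j : ℝ) + 1) * μ.real S ≤ μ.real (A m) := by
      intro m
      have h1 : 0 ≤ᵐ[μ] μ⟦A m | 𝓖⟧ :=
        condExp_nonneg (.of_forall fun ω => Set.indicator_nonneg (fun _ _ => zero_le_one) ω)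
      have h2 := mul_meas_ge_le_integral_of_nonneg h1 integrable_condExp (1 / ((j : ℝ) + 1))
      rw [integral_condExp h𝓖, integral_indicator (hA m)] at h2
      simp only [integral_const, smul_eq_mul, mul_one, measureReal_restrict_apply_univ] at h2
      refine le_trans ?_ h2
      gcongr
      · exact measure_ne_top _ _
      · exact hS.le.trans fun ω hω => hω m
    have hlim : Tendsto (fun m => μ.real (A m)) atTop (𝓝 0) := by
      have h1 := tendsto_measure_iInter_atTop (μ := μ) (fun m => (hA m).nullMeasurableSet)
        hanti ⟨0, measure_ne_top _ _⟩
      rw [h0] at h1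
      exact (ENNReal.tendsto_toReal ENNReal.zero_ne_top).comp h1
    have hS0 : μ.real S = 0 := by
      have h1 := ge_of_tendsto' hlim hle
      have h2 := measureReal_nonneg (μ := μ) (s := S)
      exact le_antisymm (by by_contra! h; linarith [mul_pos hj h]) h2
    rw [measureReal_eq_zero_iff] at hS0
    filter_upwards [measure_eq_zero_iff_ae_notMem.1 hS0] with ω hω
    simpa [hS] using hω
  filter_upwards [ae_all_iff.2 key] with ω hω ε hε
  obtain ⟨j, hj⟩ := exists_nat_one_div_lt hε
  obtain ⟨m, hm⟩ := hω j
  exact ⟨m, hm.trans hj⟩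

/-- Sets of vanishing conditional probability are null on an event of the conditioning field. -/
lemma ae_notMem_of_condProb_nonpos (h𝓖 : 𝓖 ≤ mΩ) {A : Set Ω}
    (hA : MeasurableSet A) : ∀ᵐ ω ∂μ, (μ⟦A | 𝓖⟧) ω ≤ 0 → ω ∉ A := by
  have hS : MeasurableSet[𝓖] {ω | (μ⟦A | 𝓖⟧) ω ≤ 0} :=
    @measurableSet_le _ _ _ _ _ 𝓖 _ _ _ _ _ stronglyMeasurable_condExp.measurable
      (@measurable_const _ _ _ 𝓖 _)
  have h1 := setIntegral_condExp (μ := μ) h𝓖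
    ((integrable_const (1 : ℝ)).indicator hA) hS
  have h2 : ∫ ω in {ω | (μ⟦A | 𝓖⟧) ω ≤ 0}, (μ⟦A | 𝓖⟧) ω ∂μ ≤ 0 :=
    setIntegral_nonpos (h𝓖 _ hS) fun ω hω => hω
  rw [h1, setIntegral_indicator hA] at h2
  simp only [integral_const, smul_eq_mul, mul_one, measureReal_restrict_apply_univ] at h2
  have h3 := (measureReal_eq_zero_iff (measure_ne_top _ _)).1 (le_antisymm h2 measureReal_nonneg)
  filter_upwards [measure_eq_zero_iff_ae_notMem.1 h3] with ω hω hω1 hω2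
  exact hω ⟨hω1, hω2⟩

lemma IsCondRightEndpoint.ae_le {X : Ω → ℝ} (hX : Measurable X)
    (h𝓖 : 𝓖 ≤ mΩ) {γ : Ω → EReal} (hγ : IsCondRightEndpoint μ X 𝓖 γ) :
    ∀ᵐ ω ∂μ, (X ω : EReal) ≤ γ ω :=
  (condProb_eq_one_iff h𝓖 (measurableSet_le (measurable_coe_real_ereal.comp hX)
    (hγ.measurable.mono h𝓖 le_rfl))).1 hγ.condProb_eq_one

/-- Values above a smaller threshold have positive conditional probability. -/
lemma IsCondRightEndpoint.ae_condProb_pos {X : Ω → ℝ} (hX : Measurable X)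
    (h𝓖 : 𝓖 ≤ mΩ) {γ : Ω → EReal} (hγ : IsCondRightEndpoint μ X 𝓖 γ)
    {J : Ω → EReal} (hJ : Measurable[𝓖] J) (hJγ : ∀ᵐ ω ∂μ, J ω < γ ω) :
    ∀ᵐ ω ∂μ, 0 < (μ⟦{ω' | J ω' < (X ω' : EReal)} | 𝓖⟧) ω := by
  classical
  have hA : MeasurableSet {ω' | J ω' < (X ω' : EReal)} :=
    measurableSet_lt (hJ.mono h𝓖 le_rfl) (measurable_coe_real_ereal.comp hX)
  have hS : MeasurableSet[𝓖] {ω | (μ⟦{ω' | J ω' < (X ω' : EReal)} | 𝓖⟧) ω ≤ 0} :=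
    @measurableSet_le _ _ _ _ _ 𝓖 _ _ _ _ _ stronglyMeasurable_condExp.measurable
      (@measurable_const _ _ _ 𝓖 _)
  -- Lowering γ to J where the conditional probability vanishes keeps an invariant upper bound for
  -- X, so minimality of γ makes that event null.
  let Q : Ω → EReal := fun ω =>
    if ω ∈ {ω | (μ⟦{ω' | J ω' < (X ω' : EReal)} | 𝓖⟧) ω ≤ 0} then J ω else γ ω
  have hQ : Measurable[𝓖] Q := Measurable.ite hS hJ hγ.measurable
  have hXQ : ∀ᵐ ω ∂μ, (X ω : EReal) ≤ Q ω := by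
    filter_upwards [ae_notMem_of_condProb_nonpos (μ := μ) h𝓖 hA, hγ.ae_le hX h𝓖] with ω h1 h2
    simp only [Q]
    split_ifs with h
    · exact not_lt.1 (h1 h)
    · exact h2
  have h3 := hγ.minimal Q hQ ((condProb_eq_one_iff h𝓖
    (measurableSet_le (measurable_coe_real_ereal.comp hX) (hQ.mono h𝓖 le_rfl))).2 hXQ)
  filter_upwards [h3, hJγ] with ω h4 h5
  by_contra! h6
  simp only [Q] at h4
  have h7 : ω ∈ {ω | (μ⟦{ω' | J ω' < (X ω' : EReal)} | 𝓖⟧) ω ≤ 0} := h6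
  rw [if_pos h7] at h4
  exact (h4.trans_lt h5).false

variable {X : ℕ → Ω → ℝ}

/-- Since γ is the same function of every shifted path, the indicator of (γ, X i) ∈ C is one
function F of the i-th path, and the ergodic theorem applies. -/
lemma StrictlyStationary.ae_tendsto_proportion (h : StrictlyStationary μ X)
    (hX : ∀ n, Measurable (X n)) {γ : Ω → EReal} (hγ : Measurable[invariantSigma X] γ)
    {C : Set (EReal × ℝ)} (hC : MeasurableSet C) :
    ∀ᵐ ω ∂μ, Tendsto (proportion (fun n => X n ω) fun y => (γ ω, y) ∈ C) atTop
      (𝓝 ((μ⟦{ω' | (γ ω', X 0 ω') ∈ C} | invariantSigma X⟧) ω)) := by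
  classical
  obtain ⟨g, hg, hgγ⟩ := exists_eq_comp_shiftedPath hγ
  let F : (ℕ → ℝ) → ℝ := fun x => C.indicator (fun _ => 1) (g x, x 0)
  have hF : Measurable F :=
    (measurable_const.indicator hC).comp (hg.prodMk (measurable_pi_apply 0))
  have hFX : ∀ i ω, F (shiftedPath X i ω) = if (γ ω, X i ω) ∈ C then 1 else 0 := fun i ω => by
    simp only [F, ← hgγ]
    rfl
  have hF0 : (fun ω => F (shiftedPath X 0 ω)) =
      Set.indicator {ω' | (γ ω', X 0 ω') ∈ C} fun _ => (1 : ℝ) := by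
    funext ω
    rw [hFX]
    rfl
  have hFi : Integrable (fun ω => F (shiftedPath X 0 ω)) μ := by
    rw [hF0]
    exact (integrable_const _).indicator
      (((hγ.mono (invariantSigma_le hX) le_rfl).prodMk (hX 0)) hC)
  filter_upwards [h.ae_tendsto_average hX hF hFi] with ω hω
  rw [hF0] at hω
  refine hω.congr fun n => ?_
  simp only [hFX, proportion, Finset.sum_boole]

-- The bound on X i is one Borel condition on the i-th shifted path, whose law does not depend on i.
omit [IsProbabilityMeasure μ] in
lemma StrictlyStationary.ae_forall_le (h : StrictlyStationary μ X) {γ : Ω → EReal}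
    (hγ : Measurable[invariantSigma X] γ)
    (hle : ∀ᵐ ω ∂μ, (X 0 ω : EReal) ≤ γ ω) : ∀ᵐ ω ∂μ, ∀ i, (X i ω : EReal) ≤ γ ω := by
  obtain ⟨g, hg, hgγ⟩ := exists_eq_comp_shiftedPath hγ
  have hC : MeasurableSet {x : ℕ → ℝ | (x 0 : EReal) ≤ g x} :=
    measurableSet_le (measurable_coe_real_ereal.comp (measurable_pi_apply 0)) hg
  have h0 : ∀ᵐ ω ∂μ, shiftedPath X 0 ω ∈ {x : ℕ → ℝ | (x 0 : EReal) ≤ g x} := by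
    filter_upwards [hle] with ω hω
    rw [hgγ 0] at hω
    exact hω
  refine ae_all_iff.2 fun i => ?_
  filter_upwards [(h.identDistrib_shiftedPath i).symm.ae_mem_snd hC h0] with ω hω
  rw [hgγ i]
  exact hω

/-- The proportion of near-maximal terms of a stationary sequence converges almost surely. -/
theorem StrictlyStationary.ae_tendsto_nearCount_div (h : StrictlyStationary μ X)
    (hX : ∀ n, Measurable (X n)) {a : ℝ} {k : ℕ → ℕ} (hk : ∀ n, 1 ≤ n → 1 ≤ k n ∧ k n ≤ n)
    (hk_lim : Tendsto (fun n : ℕ => (k n : ℝ) / (n : ℝ)) atTop (𝓝 1))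
    {γ : Ω → EReal} (hγ : IsCondRightEndpoint μ (X 0) (invariantSigma X) γ)
    (h_atom : μ {ω | (X 0 ω : EReal) = γ ω} = 0)
    (h_atom_a : μ {ω | (X 0 ω : EReal) = γ ω - (a : EReal)} = 0) :
    ∀ᵐ ω ∂μ, Tendsto (fun n => (nearCount (fun n => X n ω) (k n) n a : ℝ) / n) atTop
      (𝓝 (limitProportion μ (X 0) (invariantSigma X) γ a ω)) := by
  have hI := invariantSigma_le hX
  have hγm := hγ.measurable
  have hm1 : Measurable fun z : EReal × ℝ => (z.2 : EReal) :=
    measurable_coe_real_ereal.comp measurable_snd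
  have hm2 : Measurable fun z : EReal × ℝ => z.1 - (a : EReal) := by fun_prop
  have hm3 : ∀ m, Measurable fun z : EReal × ℝ => lowerThreshold z.1 m := fun m =>
    (measurable_lowerThreshold m).comp measurable_fst
  have hC1 : MeasurableSet {z : EReal × ℝ | z.1 - (a : EReal) < (z.2 : EReal)} :=
    measurableSet_lt hm2 hm1
  have hC2 : ∀ m, MeasurableSet {z : EReal × ℝ | lowerThreshold z.1 m < (z.2 : EReal)} :=
    fun m => measurableSet_lt (hm3 m) hm1
  have hC3 : ∀ m, MeasurableSet {z : EReal × ℝ | z.1 < ⊤ ∧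
      lowerThreshold z.1 m - (a : EReal) < (z.2 : EReal) ∧ (z.2 : EReal) ≤ z.1 - (a : EReal)} :=
    fun m => (measurableSet_lt measurable_fst measurable_const).inter
      ((measurableSet_lt ((hm3 m).sub_const _) hm1).inter (measurableSet_le hm1 hm2))
  have hγX : Measurable fun ω => (γ ω, X 0 ω) := (hγm.mono hI le_rfl).prodMk (hX 0)
  have hle := hγ.ae_le (hX 0) hI
  have hbot : ∀ᵐ ω ∂μ, γ ω ≠ ⊥ := by
    filter_upwards [hle] with ω hω
    exact ne_bot_of_le_ne_bot (EReal.coe_ne_bot _) hω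
  have hp_pos : ∀ᵐ ω ∂μ, ∀ m, 0 <
      (μ⟦{ω' | lowerThreshold (γ ω') m < (X 0 ω' : EReal)} | invariantSigma X⟧) ω :=
    ae_all_iff.2 fun m => hγ.ae_condProb_pos (hX 0) hI ((measurable_lowerThreshold m).comp hγm)
      (hbot.mono fun ω hω => lowerThreshold_lt hω m)
  -- The events decrease to {X 0 ≥ γ}, which is a.s. the null event {X 0 = γ}.
  have hp_inf := ae_exists_condProb_lt (μ := μ) hI (fun m => hγX (hC2 m))
    (fun m n hmn ω hω => (lowerThreshold_mono hmn).trans_lt hω) (by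
      refine measure_mono_null_ae ?_ h_atom
      filter_upwards [hle] with ω h1 h2
      refine le_antisymm h1 (not_lt.1 fun h3 => ?_)
      obtain ⟨m, hm⟩ := exists_lt_lowerThreshold h3
      exact (hm.trans (Set.mem_iInter.1 h2 m)).false)
  -- The strips shrink into the null event {X 0 = γ - a}.
  have hr_inf := ae_exists_condProb_lt (μ := μ) hI (fun m => hγX (hC3 m))
    (fun m n hmn ω hω => ⟨hω.1,
      (EReal.sub_le_sub (lowerThreshold_mono hmn) le_rfl).trans_lt hω.2.1, hω.2.2⟩) (by
      refine measure_mono_null (fun ω hω => ?_) h_atom_a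
      rw [Set.mem_iInter] at hω
      refine le_antisymm (hω 0).2.2 (not_lt.1 fun h3 => ?_)
      have h4 : ((X 0 ω + a : ℝ) : EReal) < γ ω := by
        rw [EReal.coe_add]
        exact (EReal.lt_sub_iff_add_lt (.inl (EReal.coe_ne_bot a))
          (.inl (EReal.coe_ne_top a))).1 h3
      obtain ⟨m, hm⟩ := exists_lt_lowerThreshold h4
      have h5 : lowerThreshold (γ ω) m - (a : EReal) < (X 0 ω : EReal) := (hω m).2.1
      rw [EReal.sub_lt_iff (.inl (EReal.coe_ne_bot a)) (.inl (EReal.coe_ne_top a)),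
        ← EReal.coe_add] at h5
      exact (hm.trans h5).false)
  filter_upwards [h.ae_forall_le hγm hle, h.ae_tendsto_proportion hX hγm hC1,
    ae_all_iff.2 fun m => h.ae_tendsto_proportion hX hγm (hC2 m),
    ae_all_iff.2 fun m => h.ae_tendsto_proportion hX hγm (hC3 m), hp_pos, hp_inf, hr_inf]
    with ω h1 h2 h3 h4 h5 h6 h7
  have h8 := tendsto_nearCount_div hk hk_lim h1 h2 h3 h4 h5 h6 h7
  unfold limitProportion
  rw [Set.indicator_apply]
  exact h8

end Endpoint

/-! ### Modes of convergence and random indices -/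

section Convergence

variable {Ω ι : Type*} [MeasurableSpace Ω] {μ : Measure Ω} [IsProbabilityMeasure μ] {l : Filter ι}

/-- The subsequence criterion for convergence in probability along a filter. -/
lemma tendstoInMeasure_of_subseq_ae_tendsto [l.IsCountablyGenerated] {Y : ι → Ω → ℝ} {V : Ω → ℝ}
    (hY : ∀ i, AEStronglyMeasurable (Y i) μ)
    (h : ∀ u : ℕ → ι, Tendsto u atTop l → ∃ φ : ℕ → ℕ,
      ∀ᵐ ω ∂μ, Tendsto (fun n => Y (u (φ n)) ω) atTop (𝓝 (V ω))) :
    TendstoInMeasure μ Y l V := by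
  intro ε hε
  refine tendsto_of_subseq_tendsto fun u hu => ?_
  obtain ⟨φ, hφ⟩ := h u hu
  exact ⟨φ, tendstoInMeasure_of_tendsto_ae (fun n => hY (u (φ n))) hφ ε hε⟩

omit [IsProbabilityMeasure μ] in
lemma exists_subseq_ae_tendsto {Y : ι → Ω → ℝ} {V : Ω → ℝ} (h : TendstoInMeasure μ Y l V)
    {u : ℕ → ι} (hu : Tendsto u atTop l) : ∃ φ : ℕ → ℕ, StrictMono φ ∧
      ∀ᵐ ω ∂μ, Tendsto (fun n => Y (u (φ n)) ω) atTop (𝓝 (V ω)) :=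
  (h.comp hu).exists_seq_tendsto_ae

/-- The portmanteau bound for closed sets. -/
lemma eventually_measure_closed_lt {Y : ι → Ω → ℝ} {V : Ω → ℝ}
    (h : TendstoInDistribution Y l V (fun _ => μ) μ) {F : Set ℝ} (hF : IsClosed F) {δ : ENNReal}
    (hδ : μ {ω | V ω ∈ F} < δ) : ∀ᶠ i in l, μ {ω | Y i ω ∈ F} < δ := by
  have h1 := ProbabilityMeasure.limsup_measure_closed_le_of_tendsto h.tendsto hF
  have h2 : ∀ i, (μ.map (Y i)) F = μ {ω | Y i ω ∈ F} := fun i =>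
    Measure.map_apply_of_aemeasurable (h.forall_aemeasurable i) hF.measurableSet
  have h3 : (μ.map V) F = μ {ω | V ω ∈ F} :=
    Measure.map_apply_of_aemeasurable h.aemeasurable_limit hF.measurableSet
  simp only [ProbabilityMeasure.coe_mk, h2, h3] at h1
  exact eventually_lt_of_limsup_lt (h1.trans_lt hδ)

/-- Convergence in distribution to a constant implies convergence in probability. -/
theorem tendstoInMeasure_of_tendstoInDistribution_degenerate {Y : ι → Ω → ℝ} {V : Ω → ℝ}
    (h : TendstoInDistribution Y l V (fun _ => μ) μ) (hV : Degenerate μ V) :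
    TendstoInMeasure μ Y l V := by
  obtain ⟨r, hr⟩ := hV
  refine TendstoInMeasure.congr_right (g := fun _ => r) (hr.mono fun ω hω => hω.symm) ?_
  rw [tendstoInMeasure_iff_dist]
  intro ε hε
  have hF : IsClosed {y : ℝ | ε ≤ dist y r} := isClosed_le (by fun_prop) (by fun_prop)
  rw [ENNReal.tendsto_nhds_zero]
  intro δ hδ
  refine (eventually_measure_closed_lt h hF (lt_of_le_of_lt ?_ hδ)).mono fun i hi => hi.le
  refine (measure_eq_zero_iff_ae_notMem.2 ?_).le
  filter_upwards [hr] with ω hω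
  simpa [hω] using hε

/-- If `N / c` converges in distribution to a positive limit and `c → ∞`, then `N → ∞` in
probability. -/
lemma tendstoInMeasure_inv_of_tendstoInDistribution {N : ι → Ω → ℕ} {c : ι → ℝ} {Z : Ω → ℝ}
    (hZ : Measurable Z) (hZ_pos : ∀ᵐ ω ∂μ, 0 < Z ω) (hc_pos : ∀ t, 0 < c t)
    (hc : Tendsto c l atTop)
    (h : TendstoInDistribution (fun t ω => (N t ω : ℝ) / c t) l Z (fun _ => μ) μ) :
    TendstoInMeasure μ (fun t ω => ((N t ω : ℝ) + 1)⁻¹) l fun _ => 0 := by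
  rw [tendstoInMeasure_iff_dist]
  intro ε hε
  rw [ENNReal.tendsto_nhds_zero]
  intro δ hδ
  have hlim : Tendsto (fun m : ℕ => μ {ω | Z ω ≤ 1 / ((m : ℝ) + 1)}) atTop (𝓝 0) := by
    have h1 := tendsto_measure_iInter_atTop (μ := μ)
      (s := fun m : ℕ => {ω | Z ω ≤ 1 / ((m : ℝ) + 1)})
      (fun m => (measurableSet_le hZ measurable_const).nullMeasurableSet)
      (fun m n hmn ω (hω : Z ω ≤ _) => hω.trans (by gcongr)) ⟨0, measure_ne_top _ _⟩
    have h2 : μ (⋂ m : ℕ, {ω | Z ω ≤ 1 / ((m : ℝ) + 1)}) = 0 := by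
      refine measure_eq_zero_iff_ae_notMem.2 ?_
      filter_upwards [hZ_pos] with ω hω hmem
      obtain ⟨m, hm⟩ := exists_nat_one_div_lt hω
      exact (hm.trans_le (Set.mem_iInter.1 hmem m)).false
    rwa [h2] at h1
  obtain ⟨m, hm⟩ := (hlim.eventually (gt_mem_nhds hδ)).exists
  -- If 1/(N+1) ≥ ε then N ≤ 1/ε, so c ≥ (m+1)/ε forces N/c ≤ 1/(m+1), an event of probability below
  -- δ.
  filter_upwards [eventually_measure_closed_lt h (isClosed_Iic (a := 1 / ((m : ℝ) + 1))) hm,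
    hc.eventually_ge_atTop (ε⁻¹ * ((m : ℝ) + 1))] with t h1 h2
  refine (measure_mono fun ω hω => ?_).trans h1.le
  have hN0 : (0 : ℝ) < (N t ω : ℝ) + 1 := by positivity
  have h3 : ε ≤ ((N t ω : ℝ) + 1)⁻¹ := by
    have : ε ≤ dist ((N t ω : ℝ) + 1)⁻¹ 0 := hω
    rwa [Real.dist_eq, sub_zero, abs_of_pos (by positivity)] at this
  have h4 : (N t ω : ℝ) + 1 ≤ ε⁻¹ := by
    rwa [le_inv_comm₀ hε hN0] at h3
  change (N t ω : ℝ) / c t ≤ 1 / ((m : ℝ) + 1)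
  rw [div_le_div_iff₀ (hc_pos t) (by positivity), one_mul]
  refine le_trans ?_ h2
  gcongr
  linarith

lemma tendsto_natCast_of_div_tendsto {N : ι → ℕ} {c : ι → ℝ} {z : ℝ} (hz : 0 < z)
    (hc_pos : ∀ t, 0 < c t) (hc : Tendsto c l atTop)
    (h : Tendsto (fun t => (N t : ℝ) / c t) l (𝓝 z)) : Tendsto N l atTop := by
  rw [← tendsto_natCast_atTop_iff (R := ℝ)]
  refine (h.pos_mul_atTop hz hc).congr fun t => ?_
  exact div_mul_cancel₀ _ (hc_pos t).ne'

lemma nearCount_div_eq (x : ℕ → ℝ) (k n : ℕ) (a c : ℝ) :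
    (nearCount x k n a : ℝ) / c = (n : ℝ) / c * ((nearCount x k n a : ℝ) / n) := by
  -- At n = 0 the count is zero, so division by zero does no harm.
  rcases Nat.eq_zero_or_pos n with rfl | hn
  · simp [nearCount]
  · have : (n : ℝ) ≠ 0 := by positivity
    field_simp

/-- The index filter is arbitrary so that this serves both t → ∞ and subsequences. -/
lemma tendsto_nearCount_div_of_tendsto {x : ℕ → ℝ} {k : ℕ → ℕ} {a w z : ℝ} {N : ι → ℕ}
    {c : ι → ℝ} (hx : Tendsto (fun n => (nearCount x (k n) n a : ℝ) / n) atTop (𝓝 w))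
    (hz : 0 < z) (hc_pos : ∀ t, 0 < c t) (hc : Tendsto c l atTop)
    (h : Tendsto (fun t => (N t : ℝ) / c t) l (𝓝 z)) :
    Tendsto (fun t => (nearCount x (k (N t)) (N t) a : ℝ) / c t) l (𝓝 (z * w)) := by
  simp_rw [nearCount_div_eq x _ _ a (c _)]
  exact h.mul (hx.comp (tendsto_natCast_of_div_tendsto hz hc_pos hc h))

end Convergence

end NearMax

/-- `X n` stands for the claim size with index `n + 1`, and `γ` for any version of the conditional
right endpoint of the first claim size given the invariant sigma-field of the sequence. -/
theorem theorem4p2 {Ω : Type*} [MeasurableSpace Ω] (μ : Measure Ω) [IsProbabilityMeasure μ]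
    (a : ℝ) (ha : 0 < a)
    -- the strictly stationary sequence of claim sizes
    (X : ℕ → Ω → ℝ) (hX : ∀ n, Measurable (X n)) (hstat : NearMax.StrictlyStationary μ X)
    -- the ranks
    (k : ℕ → ℕ) (hk : ∀ n, 1 ≤ n → 1 ≤ k n ∧ k n ≤ n)
    (hk_lim : Tendsto (fun n : ℕ => (k n : ℝ) / (n : ℝ)) atTop (𝓝 1))
    -- the conditional right endpoint and the two conditions on atoms
    (γ : Ω → EReal) (hγ : NearMax.IsCondRightEndpoint μ (X 0) (NearMax.invariantSigma X) γ)
    (h_atom : μ {ω | (X 0 ω : EReal) = γ ω} = 0)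
    (h_atom_a : μ {ω | (X 0 ω : EReal) = γ ω - (a : EReal)} = 0)
    -- the counting process, its normalization and the limit
    (N : ℝ≥0 → Ω → ℕ) (hN : ∀ t, Measurable (N t))
    (Z : Ω → ℝ) (hZ : Measurable Z) (hZ_pos : ∀ᵐ ω ∂μ, 0 < Z ω)
    (c : ℝ≥0 → ℝ) (hc_pos : ∀ t, 0 < c t) (hc : Tendsto c atTop atTop) :
    let K : ℝ≥0 → Ω → ℕ := fun t ω =>
      NearMax.nearCount (fun n => X n ω) (k (N t ω)) (N t ω) a
    let W : Ω → ℝ := NearMax.limitProportion μ (X 0) (NearMax.invariantSigma X) γ a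
    -- (i), almost sure convergence
    ((∀ᵐ ω ∂μ, Tendsto (fun t => (N t ω : ℝ) / c t) atTop (𝓝 (Z ω))) →
      ∀ᵐ ω ∂μ, Tendsto (fun t => (K t ω : ℝ) / c t) atTop (𝓝 (Z ω * W ω))) ∧
    -- (i), convergence in probability
    (TendstoInMeasure μ (fun t ω => (N t ω : ℝ) / c t) atTop Z →
      TendstoInMeasure μ (fun t ω => (K t ω : ℝ) / c t) atTop (fun ω => Z ω * W ω)) ∧
    -- (ii), convergence in distribution
    (TendstoInDistribution (fun t ω => (N t ω : ℝ) / c t) atTop Z (fun _ => μ) μ →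
      NearMax.Degenerate μ W →
      TendstoInDistribution (fun t ω => (K t ω : ℝ) / c t) atTop (fun ω => Z ω * W ω)
        (fun _ => μ) μ) ∧
    -- (ii), degenerate `Z`
    (TendstoInDistribution (fun t ω => (N t ω : ℝ) / c t) atTop Z (fun _ => μ) μ →
      NearMax.Degenerate μ Z →
      TendstoInMeasure μ (fun t ω => (N t ω : ℝ) / c t) atTop Z ∧
      TendstoInMeasure μ (fun t ω => (K t ω : ℝ) / c t) atTop (fun ω => Z ω * W ω)) := by
  intro K W
  have hK : ∀ t, Measurable (K t) := fun t => NearMax.measurable_nearCount_comp hX (hN t) k a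
  have hKc : ∀ t, Measurable fun ω => (K t ω : ℝ) / c t := fun t =>
    (measurable_from_nat.comp (hK t)).div_const (c t)
  have hS := hstat.ae_tendsto_nearCount_div hX hk hk_lim hγ h_atom h_atom_a
  have hprob : TendstoInMeasure μ (fun t ω => (N t ω : ℝ) / c t) atTop Z →
      TendstoInMeasure μ (fun t ω => (K t ω : ℝ) / c t) atTop (fun ω => Z ω * W ω) := by
    intro h
    refine NearMax.tendstoInMeasure_of_subseq_ae_tendsto
      (fun t => (hKc t).aestronglyMeasurable) fun u hu => ?_
    obtain ⟨φ, hφ, hlim⟩ := NearMax.exists_subseq_ae_tendsto h hu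
    refine ⟨φ, ?_⟩
    filter_upwards [hS, hZ_pos, hlim] with ω h1 h2 h3
    exact NearMax.tendsto_nearCount_div_of_tendsto h1 h2 (fun n => hc_pos _)
      (hc.comp (hu.comp hφ.tendsto_atTop)) h3
  refine ⟨fun h => ?_, hprob, fun h hW => ?_, fun h hZd => ?_⟩
  · filter_upwards [hS, hZ_pos, h] with ω h1 h2 h3
    exact NearMax.tendsto_nearCount_div_of_tendsto h1 h2 hc_pos hc h3
  · obtain ⟨r, hr⟩ := hW
    have hKN : ∀ t, Measurable fun ω => (K t ω : ℝ) / (N t ω : ℝ) := fun t =>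
      (measurable_from_nat.comp (hK t)).div (measurable_from_nat.comp (hN t))
    -- Convergence in distribution still gives N → ∞ in probability, which suffices for K/N.
    have hY : TendstoInMeasure μ (fun t ω => (K t ω : ℝ) / (N t ω : ℝ)) atTop fun _ => r := by
      refine NearMax.tendstoInMeasure_of_subseq_ae_tendsto
        (fun t => (hKN t).aestronglyMeasurable) fun u hu => ?_
      obtain ⟨φ, -, hlim⟩ := NearMax.exists_subseq_ae_tendsto
        (NearMax.tendstoInMeasure_inv_of_tendstoInDistribution hZ hZ_pos hc_pos hc h) hu
      refine ⟨φ, ?_⟩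
      filter_upwards [hS, hr, hlim] with ω h1 h2 h3
      have h4 : Tendsto (fun n => N (u (φ n)) ω) atTop atTop := by
        rw [← tendsto_natCast_atTop_iff (R := ℝ)]
        have h5 : Tendsto (fun n => ((N (u (φ n)) ω : ℝ) + 1)⁻¹) atTop (𝓝[>] 0) :=
          tendsto_nhdsWithin_iff.2 ⟨h3, .of_forall fun n => by
            simp only [Set.mem_Ioi]; positivity⟩
        have h6 := tendsto_atTop_add_const_right _ (-1) h5.inv_tendsto_nhdsGT_zero
        refine h6.congr fun n => ?_
        simp
      rw [← h2]
      exact h1.comp h4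
    -- Slutsky's theorem for the product of N/c and K/N.
    have h7 := h.continuous_comp_prodMk_of_tendstoInMeasure_const
      (g := fun z : ℝ × ℝ => z.1 * z.2) (by fun_prop) hY fun t => (hKN t).aemeasurable
    refine h7.congr (fun t => .of_forall fun ω => ?_) ?_
    · exact (NearMax.nearCount_div_eq _ _ _ _ _).symm
    · filter_upwards [hr] with ω hω
      rw [hω]
  · have h8 := NearMax.tendstoInMeasure_of_tendstoInDistribution_degenerate h hZd
    exact ⟨h8, hprob h8⟩
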